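/- A finite set $\mathcal A \subset \mathrm{End}(\mathbb C^n)$ of $k$ distinct endomorphisms is called \emph{totally symmetric} if every permutation of its elements is realized by conjugation: for every permutation $\sigma$ of the set $\mathcal A$ there is $g \in \mathrm{GL}_n(\mathbb C)$ such that $g A g^{-1} = \sigma(A)$ for all $A \in \mathcal A$. It is called \emph{commutative} if its elements commute pairwise. \textbf{Theorem.} Let $n \ge 0$, and let $\mathcal A \subset \mathrm{End}(\mathbb C^n)$ be a totally symmetric set of cardinality $k$. Then $k \le n+1$. If moreover $n \ge 1$ and $\mathcal A$ is commutative, then $k \le n$. -/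

import Mathlib

/-- A finite subset `S` of a set `X` with an action of a group `G` is *totally symmetric* if there
is a realization map `ρ` (a map of sets, not necessarily a homomorphism) from the permutation group
of `S` to `G` such that `ρ σ` acts on `S` as the permutation `σ`. -/
def IsTotallySymmetric (G : Type*) {X : Type*} [Group G] [MulAction G X] (S : Finset X) : Prop :=
  ∃ ρ : Equiv.Perm S → G, ∀ (σ : Equiv.Perm S) (x : S), ρ σ • (x : X) = (σ x : X)

/-- The general linear group of a complex vector space `V`, in the guise in which it acts on
`End(V)` by conjugation, `g • A = g * A * g⁻¹`. -/
abbrev ConjGL (V : Type*) [AddCommGroup V] [Module ℂ V] : Type _ :=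
  ConjAct (LinearMap.GeneralLinearGroup ℂ V)

/-- A totally symmetric set of endomorphisms of a complex vector space `V`: every permutation of the
set is realized by conjugation by an element of `GL(V)`. -/
def IsTotallySymmetricEnd {V : Type*} [AddCommGroup V] [Module ℂ V]
    (S : Finset (Module.End ℂ V)) : Prop :=
  IsTotallySymmetric (ConjGL V) S

/-- A set of endomorphisms is commutative if its elements commute pairwise. -/
def IsCommutativeSet {V : Type*} [AddCommGroup V] [Module ℂ V]
    (S : Finset (Module.End ℂ V)) : Prop :=
  ∀ A ∈ S, ∀ B ∈ S, A * B = B * A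

/-!
The set `S` is replaced by the injective family of its elements, and conjugation by intertwining
(`Intertwines`): a family `B` of linear maps `X → Y` is symmetric if every permutation of the index
type is induced by a pair of automorphisms of `X` and `Y`, and a family of endomorphisms is symmetric
if one can take the two automorphisms equal.

The engine is `exists_injective_block`. If subspaces `W ≤ X` and `U ≤ Y` are stable under all the
realizing automorphisms, then one of the four blocks `W → Y ⧸ U`, `W → U`, `X ⧸ W → Y ⧸ U`,
`X ⧸ W → U` carries a symmetric family that is again injective. Indeed, double transitivity of the
symmetric group makes every symmetric family injective or constant; after subtracting the average, a
constant family vanishes, so that failure of injectivity on one block lets one pass to the next.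

Stable subspaces come from fixing one index `i₀`: a permutation of the other indices is realized by
automorphisms commuting with the map at `i₀`, whose kernel, range and eigenspaces are thus stable.
Each such step costs one element of the family. Two bounds follow by a simultaneous induction:

* a symmetric family of maps `X → Y` has at most `max 1 (dim X + dim Y)` elements
  (`homBound_of_lt`). The kernel and range of `B i₀` give a block of smaller total dimension unless
  `B i₀` is bijective, in which case the maps `(B i₀)⁻¹ ∘ B i` are a symmetric family of
  endomorphisms of `X`, and `dim X + 2 ≤ 2 * dim X` once `dim X ≥ 2`;
* a symmetric family of endomorphisms of `V` has at most `dim V + 1` elements (`endBound_of_lt`).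
  For a nonscalar `A i₀`, an eigenspace `W` is stable, and each block of `(W, W)` carries at most
  `dim V` elements.

In the commutative case (`card_le_finrank_of_commute`) there are two possibilities. If `A i₀` has
several eigenvalues, the other maps preserve its Fitting decomposition and are distinguished on one
of the two summands, to which induction applies. Otherwise every `A i` is a fixed scalar plus a
nilpotent map, and the common kernel of the nilpotent parts is a proper nonzero subspace stable under
all realizing automorphisms, so that no index has to be given up.
-/

open Module

/-! ### Symmetric families of linear maps -/

section Families

variable {K : Type*} [Field K] {ι : Type*}

section Blocks

variable {X Y : Type*} [AddCommGroup X] [Module K X] [AddCommGroup Y] [Module K Y]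

/-- The automorphisms `g` of `X` and `h` of `Y` induce the permutation `σ` on the family `B` of linear
maps `X → Y`: `h ∘ B i ∘ g⁻¹ = B (σ i)`, written without inverses. For a family of endomorphisms,
`Intertwines A σ g g` says that conjugation by `g` induces `σ`. -/
def Intertwines (B : ι → X →ₗ[K] Y) (σ : Equiv.Perm ι) (g : X ≃ₗ[K] X) (h : Y ≃ₗ[K] Y) : Prop :=
  ∀ i x, h (B i x) = B (σ i) (g x)

/-- The symmetric group being doubly transitive, the equality of one pair of values at distinct
indices spreads to all pairs. -/
theorem injective_or_constant {T : Type*} (f : ι → T)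
    (hf : ∀ (σ : Equiv.Perm ι) i j, f i = f j → f (σ i) = f (σ j)) :
    Function.Injective f ∨ ∀ i j, f i = f j := by
  classical
  by_contra! hcon
  obtain ⟨hinj, a, b, hab⟩ := hcon
  simp only [Function.Injective, not_forall] at hinj
  obtain ⟨i, j, hij, hne⟩ := hinj
  have hab' : a ≠ b := fun h => hab (h ▸ rfl)
  have h1 : Equiv.swap i a j ≠ a := by
    intro h
    apply hne
    apply (Equiv.swap i a).injective
    rw [h, Equiv.swap_apply_left]
  have := hf (Equiv.swap (Equiv.swap i a j) b * Equiv.swap i a) i j hij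
  rw [Equiv.Perm.mul_apply, Equiv.Perm.mul_apply, Equiv.swap_apply_left,
    Equiv.swap_apply_left, Equiv.swap_apply_of_ne_of_ne h1.symm hab'] at this
  exact hab this

theorem Intertwines.eq_map {B : ι → X →ₗ[K] Y} {σ : Equiv.Perm ι} {g : X ≃ₗ[K] X}
    {h : Y ≃ₗ[K] Y} (H : Intertwines B σ g h) {i j : ι} (hij : B i = B j) :
    B (σ i) = B (σ j) := by
  ext x
  obtain ⟨y, rfl⟩ := g.surjective x
  rw [← H, ← H, hij]

theorem Intertwines.injective_or_constant {B : ι → X →ₗ[K] Y}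
    (H : ∀ σ, ∃ g h, Intertwines B σ g h) : Function.Injective B ∨ ∀ i j, B i = B j :=
  _root_.injective_or_constant B fun σ _ _ hij =>
    let ⟨_, _, hgh⟩ := H σ
    hgh.eq_map hij

/-- A symmetric injective family of maps `X → Y` with stable subspaces `W ≤ X` and `U ≤ Y` induces an
injective family on one of the four blocks. The new family is intertwined by the automorphisms
that `g` and `h` induce, so that taking `Y = X`, `U = W` and `h = g` yields families of endomorphisms
on the two diagonal blocks. -/
theorem exists_injective_block [Fintype ι] [CharZero K] {B : ι → X →ₗ[K] Y}
    (hB : Function.Injective B) (W : Submodule K X) (U : Submodule K Y)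
    (hsym : ∀ σ, ∃ (g : X ≃ₗ[K] X) (h : Y ≃ₗ[K] Y),
      W.map (g : X →ₗ[K] X) = W ∧ U.map (h : Y →ₗ[K] Y) = U ∧ Intertwines B σ g h) :
    (∃ C : ι → W →ₗ[K] Y ⧸ U, Function.Injective C ∧
      ∀ σ g h hg hh, Intertwines B σ g h →
        Intertwines C σ (g.ofSubmodules W W hg) (Submodule.Quotient.equiv U U h hh)) ∨
    (∃ C : ι → W →ₗ[K] U, Function.Injective C ∧
      ∀ σ g h hg hh, Intertwines B σ g h →
        Intertwines C σ (g.ofSubmodules W W hg) (h.ofSubmodules U U hh)) ∨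
    (∃ C : ι → X ⧸ W →ₗ[K] Y ⧸ U, Function.Injective C ∧
      ∀ σ g h hg hh, Intertwines B σ g h →
        Intertwines C σ (Submodule.Quotient.equiv W W g hg)
          (Submodule.Quotient.equiv U U h hh)) ∨
    (∃ C : ι → X ⧸ W →ₗ[K] U, Function.Injective C ∧
      ∀ σ g h hg hh, Intertwines B σ g h →
        Intertwines C σ (Submodule.Quotient.equiv W W g hg) (h.ofSubmodules U U hh)) := by
  rcases isEmpty_or_nonempty ι with hι | hι
  · exact Or.inl ⟨fun i => isEmptyElim i, fun i => isEmptyElim i,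
      fun _ _ _ _ _ _ i => isEmptyElim i⟩
  have hcard : (Fintype.card ι : K) ≠ 0 := Nat.cast_ne_zero.2 Fintype.card_ne_zero
  -- A constant family with vanishing sum is zero.
  have hzero : ∀ {Z : Type _} [AddCommGroup Z] [Module K Z] (c : ι → Z), (∀ i j, c i = c j) →
      ∑ i, c i = 0 → ∀ i, c i = 0 := by
    intro Z _ _ c hc hs i
    have h1 : ∑ j, c j = (Fintype.card ι : K) • c i := by
      rw [Finset.sum_congr rfl fun j _ => hc j i, Finset.sum_const, Finset.card_univ,
        Nat.cast_smul_eq_nsmul]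
    exact (smul_eq_zero.1 (h1 ▸ hs)).resolve_left hcard
  by_cases h1 : Function.Injective fun i => (U.mkQ ∘ₗ B i ∘ₗ W.subtype)
  · refine Or.inl ⟨_, h1, fun σ g h hg hh H i x => ?_⟩
    simp [H i x.1]
  refine Or.inr ?_
  have c1 := (Intertwines.injective_or_constant (B := fun i => U.mkQ ∘ₗ B i ∘ₗ W.subtype)
    fun σ => by
      obtain ⟨g, h, hg, hh, H⟩ := hsym σ
      refine ⟨g.ofSubmodules W W hg, Submodule.Quotient.equiv U U h hh, fun i x => ?_⟩
      simp [H i x.1]).resolve_left h1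
  -- Without the average, constancy of the family on a block means that it vanishes there.
  set D : ι → X →ₗ[K] Y := fun i => B i - (Fintype.card ι : K)⁻¹ • ∑ j, B j with hD
  have hDinj : Function.Injective D := fun i j hij => hB (sub_left_injective hij)
  have hDs : ∑ i, D i = 0 := by
    simp only [hD, Finset.sum_sub_distrib, Finset.sum_const, Finset.card_univ]
    rw [← Nat.cast_smul_eq_nsmul K, smul_smul, mul_inv_cancel₀ hcard, one_smul, sub_self]
  have hDH : ∀ {σ g h}, Intertwines B σ g h → Intertwines D σ g h := by
    intro σ g h H i x
    simp only [hD, LinearMap.sub_apply, LinearMap.smul_apply, LinearMap.sum_apply, map_sub,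
      map_smul, map_sum, H _ x]
    rw [Equiv.sum_comp σ fun j => B j (g x)]
  have hDsx : ∀ x, ∑ i, D i x = 0 := fun x => by
    rw [← LinearMap.sum_apply, hDs, LinearMap.zero_apply]
  have m1 : ∀ i, ∀ x ∈ W, D i x ∈ U := by
    intro i x hx
    rw [← Submodule.Quotient.mk_eq_zero]
    refine hzero (fun i => U.mkQ (D i x)) (fun i j => ?_) ?_ i
    · have := LinearMap.congr_fun (c1 i j) ⟨x, hx⟩
      simpa [hD] using this
    · rw [← map_sum, hDsx, map_zero]
  by_cases h2 : Function.Injective fun i => (D i).restrict (m1 i)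
  · refine Or.inl ⟨_, h2, fun σ g h hg hh H i x => ?_⟩
    ext
    simp [hDH H i x.1]
  refine Or.inr ?_
  have c2 := (Intertwines.injective_or_constant (B := fun i => (D i).restrict (m1 i))
    fun σ => by
      obtain ⟨g, h, hg, hh, H⟩ := hsym σ
      refine ⟨g.ofSubmodules W W hg, h.ofSubmodules U U hh, fun i x => ?_⟩
      ext
      simp [hDH H i x.1]).resolve_left h2
  have m2 : ∀ i, ∀ x ∈ W, D i x = 0 := by
    intro i x hx
    refine hzero (fun i => D i x) (fun i j => ?_) (hDsx x) i
    simpa using congrArg Subtype.val (LinearMap.congr_fun (c2 i j) ⟨x, hx⟩)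
  by_cases h3 : Function.Injective fun i => W.mapQ U (D i) (m1 i)
  · refine Or.inl ⟨_, h3, fun σ g h hg hh H i x => ?_⟩
    obtain ⟨x, rfl⟩ := W.mkQ_surjective x
    simp [hDH H i x]
  refine Or.inr ?_
  have c3 := (Intertwines.injective_or_constant (B := fun i => W.mapQ U (D i) (m1 i))
    fun σ => by
      obtain ⟨g, h, hg, hh, H⟩ := hsym σ
      refine ⟨Submodule.Quotient.equiv W W g hg, Submodule.Quotient.equiv U U h hh,
        fun i x => ?_⟩
      obtain ⟨x, rfl⟩ := W.mkQ_surjective x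
      simp [hDH H i x]).resolve_left h3
  have m3 : ∀ i x, D i x ∈ U := by
    intro i x
    rw [← Submodule.Quotient.mk_eq_zero]
    refine hzero (fun i => U.mkQ (D i x)) (fun i j => ?_) ?_ i
    · simpa using LinearMap.congr_fun (c3 i j) (W.mkQ x)
    · rw [← map_sum, hDsx, map_zero]
  refine ⟨fun i => W.liftQ ((D i).codRestrict U (m3 i)) fun x hx => by
    ext; simpa using m2 i x hx, fun i j hij => hDinj ?_, fun σ g h hg hh H i x => ?_⟩
  · ext x
    exact congrArg Subtype.val (LinearMap.congr_fun hij (W.mkQ x))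
  · obtain ⟨x, rfl⟩ := W.mkQ_surjective x
    ext
    exact hDH H i x

/-- A permutation of the indices other than `i₀` is realized by automorphisms that commute with
`B i₀`. -/
theorem Intertwines.subtype_ne {B : ι → X →ₗ[K] Y} {i₀ : ι} [DecidableEq ι]
    {σ : Equiv.Perm {i // i ≠ i₀}} {g : X ≃ₗ[K] X} {h : Y ≃ₗ[K] Y}
    (H : Intertwines B (Equiv.Perm.ofSubtype σ) g h) :
    (∀ x, h (B i₀ x) = B i₀ (g x)) ∧
      Intertwines (fun i : {i // i ≠ i₀} => B i) σ g h := by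
  refine ⟨fun x => ?_, fun i x => ?_⟩
  · rw [H, Equiv.Perm.ofSubtype_apply_of_not_mem σ (by simp)]
  · rw [H, Equiv.Perm.ofSubtype_apply_coe]

theorem map_eq_of_forall_mem [FiniteDimensional K X] (g : X ≃ₗ[K] X) {W : Submodule K X}
    (h : ∀ x ∈ W, g x ∈ W) : W.map (g : X →ₗ[K] X) = W :=
  Submodule.eq_of_le_of_finrank_eq (Submodule.map_le_iff_le_comap.2 h) (g.finrank_map_eq W)

theorem card_le_one_of_eq_zero [Fintype ι] {B : ι → X →ₗ[K] Y} (hB : Function.Injective B)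
    (hsym : ∀ σ, ∃ g h, Intertwines B σ g h) {i₀ : ι} (h0 : B i₀ = 0) : Fintype.card ι ≤ 1 := by
  classical
  have key : ∀ i, B i = 0 := by
    intro i
    obtain ⟨g, h, H⟩ := hsym (Equiv.swap i₀ i)
    ext x
    obtain ⟨y, rfl⟩ := g.surjective x
    have := H i₀ y
    rw [Equiv.swap_apply_left, h0] at this
    simpa using this.symm
  exact Fintype.card_le_one_iff.2 fun i j => hB ((key i).trans (key j).symm)

theorem Intertwines.sub_smul_one {A : ι → End K X} {σ : Equiv.Perm ι} {g : X ≃ₗ[K] X}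
    (H : Intertwines A σ g g) (c : K) : Intertwines (fun i => A i - c • (1 : End K X)) σ g g := by
  intro i x
  simp [H i x]

theorem card_le_one_of_eq_smul_one [Fintype ι] {A : ι → End K X} (hA : Function.Injective A)
    (hsym : ∀ σ, ∃ g, Intertwines A σ g g) {i₀ : ι} {c : K} (h0 : A i₀ = c • 1) :
    Fintype.card ι ≤ 1 :=
  card_le_one_of_eq_zero (B := fun i => A i - c • (1 : End K X)) (i₀ := i₀)
    (fun i j hij => hA (sub_left_injective hij))
    (fun σ => let ⟨g, H⟩ := hsym σ; ⟨g, g, H.sub_smul_one c⟩) (by simp [h0])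

end Blocks

theorem card_eq_card_subtype_ne_add_one [Fintype ι] [DecidableEq ι] (i₀ : ι) :
    Fintype.card ι = Fintype.card {i // i ≠ i₀} + 1 := by
  have := Fintype.card_pos_iff.2 ⟨i₀⟩
  rw [Fintype.card_subtype_compl, Fintype.card_subtype_eq]
  omega

end Families

/-! ### The bounds for linear maps and for endomorphisms -/

universe u v w

section Bounds

variable (K : Type w) [Field K]

/-- Every symmetric family of distinct linear maps `X → Y` with `dim X + dim Y = N` has at most
`max 1 N` members; the maximum accounts for the zero map between zero spaces. -/
def HomBound (N : ℕ) : Prop :=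
  ∀ (ι : Type v) [Fintype ι] (X Y : Type u) [AddCommGroup X] [Module K X] [FiniteDimensional K X]
    [AddCommGroup Y] [Module K Y] [FiniteDimensional K Y] (B : ι → X →ₗ[K] Y),
    Function.Injective B → (∀ σ, ∃ g h, Intertwines B σ g h) →
    finrank K X + finrank K Y = N → Fintype.card ι ≤ max 1 N

/-- Every symmetric family of distinct endomorphisms of an `N`-dimensional space has at most `N + 1`
members. -/
def EndBound (N : ℕ) : Prop :=
  ∀ (ι : Type v) [Fintype ι] (V : Type u) [AddCommGroup V] [Module K V] [FiniteDimensional K V]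
    (A : ι → End K V), Function.Injective A → (∀ σ, ∃ g, Intertwines A σ g g) →
    finrank K V = N → Fintype.card ι ≤ N + 1

variable {K}

theorem exists_eigenspace_ne_top [IsAlgClosed K] {V : Type*} [AddCommGroup V] [Module K V]
    [FiniteDimensional K V] {f : End K V} (hf : ∀ c : K, f ≠ c • 1) :
    ∃ c : K, LinearMap.ker (f - c • 1) ≠ ⊥ ∧ LinearMap.ker (f - c • 1) ≠ ⊤ := by
  have : Nontrivial V := by
    by_contra h
    rw [not_nontrivial_iff_subsingleton] at h
    exact hf 0 (Subsingleton.elim _ _)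
  obtain ⟨c, hc⟩ := End.exists_eigenvalue f
  refine ⟨c, ?_, fun h => hf c (sub_eq_zero.1 (LinearMap.ker_eq_top.1 h))⟩
  obtain ⟨x, hx⟩ := hc.exists_hasEigenvector
  refine (Submodule.ne_bot_iff _).2 ⟨x, ?_, hx.2⟩
  simp [hx.apply_eq_smul]

variable [CharZero K]

/-- A proper nonzero stable subspace `W` improves the bound `dim V + 1` to `dim V`: both `W` and
`V ⧸ W` have smaller dimension than `V`, and the off-diagonal blocks are maps between spaces whose
dimensions add up to `dim V`. -/
theorem card_le_finrank_of_stable {ι : Type v} [Fintype ι] {V : Type u} [AddCommGroup V]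
    [Module K V] [FiniteDimensional K V] {A : ι → End K V} (hA : Function.Injective A)
    {W : Submodule K V} (hbot : W ≠ ⊥) (htop : W ≠ ⊤)
    (hsym : ∀ σ, ∃ g : V ≃ₗ[K] V, (∀ x ∈ W, g x ∈ W) ∧ Intertwines A σ g g)
    (hHom : HomBound.{u, v} K (finrank K V))
    (hEnd : ∀ m < finrank K V, EndBound.{u, v} K m) : Fintype.card ι ≤ finrank K V := by
  have hsym' : ∀ σ, ∃ g : V ≃ₗ[K] V, W.map (g : V →ₗ[K] V) = W ∧ Intertwines A σ g g :=
    fun σ => let ⟨g, hg, H⟩ := hsym σ; ⟨g, map_eq_of_forall_mem g hg, H⟩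
  have d1 := W.finrank_quotient_add_finrank
  have d2 := Submodule.finrank_lt htop
  have d3 : 0 < finrank K W := Submodule.one_le_finrank_iff.2 hbot
  rcases exists_injective_block hA W W
    fun σ => let ⟨g, hg, H⟩ := hsym' σ; ⟨g, g, hg, hg, H⟩ with
    ⟨C, hC, HC⟩ | ⟨C, hC, HC⟩ | ⟨C, hC, HC⟩ | ⟨C, hC, HC⟩
  · have := hHom ι _ _ C hC
      (fun σ => let ⟨g, hg, H⟩ := hsym' σ; ⟨_, _, HC σ g g hg hg H⟩) (by omega)
    omega
  · have := hEnd _ d2 ι _ C hC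
      (fun σ => let ⟨g, hg, H⟩ := hsym' σ; ⟨_, HC σ g g hg hg H⟩) rfl
    omega
  · have := hEnd (finrank K (V ⧸ W)) (by omega) ι _ C hC
      (fun σ => let ⟨g, hg, H⟩ := hsym' σ; ⟨_, HC σ g g hg hg H⟩) rfl
    omega
  · have := hHom ι _ _ C hC
      (fun σ => let ⟨g, hg, H⟩ := hsym' σ; ⟨_, _, HC σ g g hg hg H⟩) (by omega)
    omega

theorem homBound_of_lt {N : ℕ} (hHom : ∀ m < N, HomBound.{u, v} K m)
    (hEnd : ∀ m < N, EndBound.{u, v} K m) : HomBound.{u, v} K N := by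
  classical
  intro ι _ X Y _ _ _ _ _ _ B hB hsym hN
  rcases isEmpty_or_nonempty ι with hι | ⟨⟨i₀⟩⟩
  · simp
  by_cases h0 : B i₀ = 0
  · exact (card_le_one_of_eq_zero hB hsym h0).trans (le_max_left _ _)
  rw [card_eq_card_subtype_ne_add_one i₀]
  have hB' : Function.Injective fun i : {i // i ≠ i₀} => B i := hB.comp Subtype.val_injective
  have dX := (LinearMap.ker (B i₀)).finrank_quotient_add_finrank
  have dY := (LinearMap.range (B i₀)).finrank_quotient_add_finrank
  have dr := (B i₀).finrank_range_add_finrank_ker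
  have r0 : 0 < finrank K (LinearMap.range (B i₀)) :=
    Submodule.one_le_finrank_iff.2 fun h => h0 (LinearMap.range_eq_bot.1 h)
  by_cases hbij : Function.Bijective (B i₀)
  · -- Composing with the inverse of `B i₀` turns the other maps into endomorphisms of `X`.
    set e := LinearEquiv.ofBijective (B i₀) hbij with he
    have hee : ∀ x, e x = B i₀ x := fun x => rfl
    have hC : Function.Injective
        fun i : {i // i ≠ i₀} => (e.symm.toLinearMap ∘ₗ B i : End K X) := by
      intro i j hij
      apply hB'
      ext x
      exact e.symm.injective (LinearMap.congr_fun hij x)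
    have hCsym : ∀ σ, ∃ g, Intertwines
        (fun i : {i // i ≠ i₀} => (e.symm.toLinearMap ∘ₗ B i : End K X)) σ g g := by
      intro σ
      obtain ⟨g, h, H⟩ := hsym (Equiv.Perm.ofSubtype σ)
      obtain ⟨h1, h2⟩ := H.subtype_ne
      refine ⟨g, fun i x => e.injective ?_⟩
      have := h1 (e.symm (B i x))
      rw [← hee, ← hee, e.apply_symm_apply] at this
      simpa [← this] using h2 i x
    have hXY := e.finrank_eq
    -- In dimension one, the bound `dim X + 1` for endomorphisms is not sufficient; but there all
    -- endomorphisms are scalar.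
    by_cases hX1 : finrank K X = 1
    · rcases isEmpty_or_nonempty {i // i ≠ i₀} with hι | ⟨⟨j⟩⟩
      · simp
      obtain ⟨c, hc, -⟩ := LinearMap.existsUnique_eq_smul_id_of_finrank_eq_one hX1
        (e.symm.toLinearMap ∘ₗ B j : End K X)
      have := card_le_one_of_eq_smul_one hC hCsym (i₀ := j) (c := c) hc
      omega
    · have := hEnd (finrank K X) (by omega) _ X _ hC hCsym rfl
      omega
  have hsym' : ∀ σ, ∃ (g : X ≃ₗ[K] X) (h : Y ≃ₗ[K] Y),
      (LinearMap.ker (B i₀)).map (g : X →ₗ[K] X) = LinearMap.ker (B i₀) ∧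
      (LinearMap.range (B i₀)).map (h : Y →ₗ[K] Y) = LinearMap.range (B i₀) ∧
      Intertwines (fun i : {i // i ≠ i₀} => B i) σ g h := by
    intro σ
    obtain ⟨g, h, H⟩ := hsym (Equiv.Perm.ofSubtype σ)
    obtain ⟨h1, h2⟩ := H.subtype_ne
    refine ⟨g, h, map_eq_of_forall_mem g fun x hx => ?_, map_eq_of_forall_mem h ?_, h2⟩
    · rw [LinearMap.mem_ker] at hx ⊢
      rw [← h1, hx, map_zero]
    · rintro _ ⟨x, rfl⟩
      exact ⟨g x, (h1 x).symm⟩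
  -- This excludes the block `X ⧸ W → U` being all of `X → Y`.
  have hnb : 0 < finrank K (LinearMap.ker (B i₀)) ∨
      finrank K (LinearMap.range (B i₀)) < finrank K Y := by
    by_contra! hcon
    refine hbij ⟨LinearMap.ker_eq_bot.1 ?_, LinearMap.range_eq_top.1 ?_⟩
    · exact Submodule.finrank_eq_zero.1 (by omega)
    · exact Submodule.eq_top_of_finrank_eq (by omega)
  rcases exists_injective_block hB' _ _ hsym' with
    ⟨C, hC, HC⟩ | ⟨C, hC, HC⟩ | ⟨C, hC, HC⟩ | ⟨C, hC, HC⟩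
  all_goals
    have := hHom _ ?_ _ _ _ C hC
      (fun σ => let ⟨g, h, hg, hh, H⟩ := hsym' σ; ⟨_, _, HC σ g h hg hh H⟩) rfl
    all_goals omega

theorem endBound_of_lt [IsAlgClosed K] {N : ℕ} (hHom : HomBound.{u, v} K N)
    (hEnd : ∀ m < N, EndBound.{u, v} K m) : EndBound.{u, v} K N := by
  classical
  rintro ι _ V _ _ _ A hA hsym rfl
  rcases isEmpty_or_nonempty ι with hι | ⟨⟨i₀⟩⟩
  · simp
  by_cases h0 : ∃ c : K, A i₀ = c • 1
  · obtain ⟨c, hc⟩ := h0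
    exact (card_le_one_of_eq_smul_one hA hsym hc).trans (by omega)
  push Not at h0
  obtain ⟨c, hbot, htop⟩ := exists_eigenspace_ne_top h0
  rw [card_eq_card_subtype_ne_add_one i₀]
  refine Nat.succ_le_succ (card_le_finrank_of_stable (A := fun i : {i // i ≠ i₀} => A i)
    (hA.comp Subtype.val_injective) hbot htop (fun σ => ?_) hHom hEnd)
  obtain ⟨g, H⟩ := hsym (Equiv.Perm.ofSubtype σ)
  obtain ⟨h1, h2⟩ := (H.sub_smul_one c).subtype_ne
  refine ⟨g, fun x hx => ?_, H.subtype_ne.2⟩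
  rw [LinearMap.mem_ker] at hx ⊢
  rw [← h1, hx, map_zero]

variable [IsAlgClosed K]

theorem homBound_and_endBound (N : ℕ) : HomBound.{u, v} K N ∧ EndBound.{u, v} K N := by
  induction N using Nat.strong_induction_on with
  | _ N ih =>
    have hHom := homBound_of_lt (fun m hm => (ih m hm).1) fun m hm => (ih m hm).2
    exact ⟨hHom, endBound_of_lt hHom fun m hm => (ih m hm).2⟩

/-! ### Commuting families -/

/-- The common kernel of commuting nilpotent maps is nonzero, and it is stable under every realizing
automorphism. -/
theorem card_le_finrank_of_isNilpotent {ι : Type v} [Fintype ι] {V : Type u} [AddCommGroup V]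
    [Module K V] [FiniteDimensional K V] [Nontrivial V] {A : ι → End K V}
    (hA : Function.Injective A) (hsym : ∀ σ, ∃ g, Intertwines A σ g g)
    (hcomm : ∀ i j, Commute (A i) (A j)) (hnil : ∀ i, IsNilpotent (A i)) :
    Fintype.card ι ≤ finrank K V := by
  classical
  rcases isEmpty_or_nonempty ι with hι | ⟨⟨i₀⟩⟩
  · simp
  have hpos : 0 < finrank K V := finrank_pos
  by_cases h0 : A i₀ = 0
  · exact (card_le_one_of_eq_zero hA (fun σ => let ⟨g, H⟩ := hsym σ; ⟨g, g, H⟩) h0).trans hpos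
  have hker : ∀ s : Finset ι, ∃ x ≠ 0, ∀ i ∈ s, A i x = 0 := by
    intro s
    induction s using Finset.induction_on with
    | empty => simpa using exists_ne (0 : V)
    | insert j s _ ih =>
      obtain ⟨x, hx, hs⟩ := ih
      -- The last nonzero vector of `x, A j x, (A j) ^ 2 x, …`.
      have hex : ∃ m, (A j ^ m) x = 0 := let ⟨m, hm⟩ := hnil j; ⟨m, by simp [hm]⟩
      obtain ⟨m, hm⟩ : ∃ m, Nat.find hex = m + 1 :=
        Nat.exists_eq_succ_of_ne_zero fun h => hx (by simpa [h] using Nat.find_spec hex)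
      refine ⟨(A j ^ m) x, Nat.find_min hex (by omega), fun i hi => ?_⟩
      rcases Finset.mem_insert.1 hi with rfl | hi
      · have := Nat.find_spec hex
        rwa [hm, pow_succ'] at this
      · have := LinearMap.congr_fun ((hcomm i j).pow_right m).eq x
        simpa [hs i hi] using this
  obtain ⟨x, hx, hxs⟩ := hker Finset.univ
  refine card_le_finrank_of_stable hA (W := ⨅ i, LinearMap.ker (A i)) ?_ ?_ (fun σ => ?_)
    (homBound_and_endBound _).1 fun m _ => (homBound_and_endBound m).2
  · exact (Submodule.ne_bot_iff _).2 ⟨x, by simpa using hxs, hx⟩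
  · exact fun h => h0 (LinearMap.ker_eq_top.1 (top_le_iff.1 (h ▸ iInf_le _ i₀)))
  · obtain ⟨g, H⟩ := hsym σ
    refine ⟨g, fun x hx => ?_, H⟩
    simp only [Submodule.mem_iInf, LinearMap.mem_ker] at hx ⊢
    intro i
    obtain ⟨j, rfl⟩ := σ.surjective i
    rw [← H, hx, map_zero]

theorem card_le_finrank_of_commute (n : ℕ) : ∀ {ι : Type v} [Fintype ι] {V : Type u}
    [AddCommGroup V] [Module K V] [FiniteDimensional K V] [Nontrivial V] {A : ι → End K V},
    Function.Injective A → (∀ σ, ∃ g, Intertwines A σ g g) → (∀ i j, Commute (A i) (A j)) →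
    finrank K V = n → Fintype.card ι ≤ n := by
  classical
  induction n using Nat.strong_induction_on with
  | _ n ih =>
  rintro ι _ V _ _ _ _ A hA hsym hcomm rfl
  rcases isEmpty_or_nonempty ι with hι | ⟨⟨i₀⟩⟩
  · simp
  have hpos : 0 < finrank K V := finrank_pos
  obtain ⟨c, hc⟩ := End.exists_eigenvalue (A i₀)
  obtain ⟨x, hx⟩ := hc.exists_hasEigenvector
  set f : End K V := A i₀ - c • 1 with hf
  have hfx : f x = 0 := by simp [hf, hx.apply_eq_smul]
  obtain ⟨m, hm1, hm⟩ := ((Filter.eventually_ge_atTop 1).and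
    f.eventually_isCompl_ker_pow_range_pow).exists
  by_cases hnil : f ^ m = 0
  · refine card_le_finrank_of_isNilpotent (A := fun i => A i - c • (1 : End K V))
      (fun i j hij => hA (sub_left_injective hij))
      (fun σ => let ⟨g, H⟩ := hsym σ; ⟨g, H.sub_smul_one c⟩)
      (fun i j => ?_) fun i => ⟨m, ?_⟩
    · exact ((hcomm i j).sub_left ((Commute.one_left _).smul_left c)).sub_right
        ((Commute.one_right _).smul_right c)
    · obtain ⟨g, H⟩ := hsym (Equiv.swap i₀ i)
      have H' := H.sub_smul_one c i₀
      simp only [Equiv.swap_apply_left] at H'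
      have hpow : ∀ (k : ℕ) (y : V), g ((f ^ k) y) = ((A i - c • (1 : End K V)) ^ k) (g y) := by
        intro k
        induction k with
        | zero => simp
        | succ k ihk =>
          intro y
          rw [pow_succ, pow_succ, Module.End.mul_apply, Module.End.mul_apply, ihk, H']
      ext y
      obtain ⟨y, rfl⟩ := g.surjective y
      rw [← hpow, hnil]
      simp
  have hcommf : ∀ {F : End K V}, Commute F (A i₀) → Commute F (f ^ m) := fun hF =>
    (hF.sub_right ((Commute.one_right _).smul_right c)).pow_right m
  -- If the other maps are distinguished on a subspace of smaller dimension stable under the commutant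
  -- of `f ^ m`, then the induction hypothesis applies there.
  have key : ∀ T : Submodule K V, (∀ F : End K V, Commute F (f ^ m) → ∀ y ∈ T, F y ∈ T) →
      T ≠ ⊥ → T ≠ ⊤ → (¬ ∀ i j : {i // i ≠ i₀}, ∀ y ∈ T, A i y = A j y) →
      Fintype.card ι ≤ finrank K V := by
    intro T hT hbot htop hne
    have hlt := Submodule.finrank_lt htop
    have hstab : ∀ i, ∀ y ∈ T, A i y ∈ T := fun i => hT _ (hcommf (hcomm i i₀))
    have hsymT : ∀ σ, ∃ g, Intertwines
        (fun i : {i // i ≠ i₀} => ((A i).restrict (hstab i) : End K T)) σ g g := by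
      intro σ
      obtain ⟨g, H⟩ := hsym (Equiv.Perm.ofSubtype σ)
      obtain ⟨h1, h2⟩ := H.subtype_ne
      have hg := map_eq_of_forall_mem g (hT (g : V →ₗ[K] V) (hcommf (LinearMap.ext h1)))
      refine ⟨g.ofSubmodules T T hg, fun i y => ?_⟩
      ext
      simpa using h2 i y
    have hinj := (Intertwines.injective_or_constant
      fun σ => let ⟨g, H⟩ := hsymT σ; ⟨g, g, H⟩).resolve_right fun hconst => hne fun i j y hy => by
        simpa using congrArg Subtype.val (LinearMap.congr_fun (hconst i j) ⟨y, hy⟩)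
    have : Nontrivial T := Submodule.nontrivial_iff_ne_bot.2 hbot
    have := ih _ hlt hinj hsymT (fun i j => ?_) rfl
    · rw [card_eq_card_subtype_ne_add_one i₀]
      omega
    · ext y
      simpa using LinearMap.congr_fun (hcomm i j) y
  have hkb : LinearMap.ker (f ^ m) ≠ ⊥ := by
    refine (Submodule.ne_bot_iff _).2 ⟨x, ?_, hx.2⟩
    obtain ⟨k, rfl⟩ := Nat.exists_eq_add_of_le' hm1
    simp [pow_succ, hfx]
  have hrb : LinearMap.range (f ^ m) ≠ ⊥ := fun h => hnil (LinearMap.range_eq_bot.1 h)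
  by_contra hcard
  have hk : ∀ i j : {i // i ≠ i₀}, ∀ y ∈ LinearMap.ker (f ^ m), A i y = A j y := by
    by_contra h
    refine hcard (key _ (fun F hF y hy => ?_) hkb
      (fun h => hrb (eq_bot_of_top_isCompl (h ▸ hm))) h)
    have := LinearMap.congr_fun hF.eq y
    simp_all
  have hr : ∀ i j : {i // i ≠ i₀}, ∀ y ∈ LinearMap.range (f ^ m), A i y = A j y := by
    by_contra h
    refine hcard (key _ ?_ hrb (fun h => hkb (eq_bot_of_isCompl_top (h ▸ hm))) h)
    rintro F hF _ ⟨y, rfl⟩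
    exact ⟨F y, (LinearMap.congr_fun hF.eq y).symm⟩
  have hsub : Fintype.card {i // i ≠ i₀} ≤ 1 := by
    refine Fintype.card_le_one_iff.2 fun i j => Subtype.ext (hA (LinearMap.ext fun y => ?_))
    obtain ⟨a, ha, b, hb, rfl⟩ := Submodule.mem_sup.1 (hm.sup_eq_top ▸ Submodule.mem_top (x := y))
    rw [map_add, map_add, hk i j a ha, hr i j b hb]
  have h2 := Submodule.finrank_add_eq_of_isCompl hm
  have d1 := Submodule.one_le_finrank_iff.2 hkb
  have d2 := Submodule.one_le_finrank_iff.2 hrb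
  rw [card_eq_card_subtype_ne_add_one i₀] at hcard
  omega

end Bounds

/-! ### Totally symmetric sets -/

theorem exists_intertwines_of_isTotallySymmetricEnd {V : Type*} [AddCommGroup V] [Module ℂ V]
    {S : Finset (Module.End ℂ V)} (hS : IsTotallySymmetricEnd S) (σ : Equiv.Perm S) :
    ∃ g, Intertwines (fun A : S => (A : End ℂ V)) σ g g := by
  obtain ⟨ρ, hρ⟩ := hS
  refine ⟨LinearMap.GeneralLinearGroup.toLinearEquiv (ConjAct.ofConjAct (ρ σ)), fun A x => ?_⟩
  have h := hρ σ A
  rw [ConjAct.units_smul_def, Units.mul_inv_eq_iff_eq_mul] at h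
  exact LinearMap.congr_fun h x

theorem theoremA (n : ℕ) (S : Finset (Module.End ℂ (Fin n → ℂ)))
    (hS : IsTotallySymmetricEnd S) :
    S.card ≤ n + 1 ∧ (1 ≤ n → IsCommutativeSet S → S.card ≤ n) := by
  have hsym := exists_intertwines_of_isTotallySymmetricEnd hS
  rw [← Fintype.card_coe S]
  refine ⟨(homBound_and_endBound n).2 S _ _ Subtype.val_injective hsym (by simp),
    fun hn hcomm => ?_⟩
  have : NeZero n := ⟨by omega⟩
  exact card_le_finrank_of_commute n Subtype.val_injective hsym
    (fun A B => hcomm A A.2 B B.2) (by simp)
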